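/- Throughout, ${}_2F_3\left[\begin{smallmatrix}u_1,u_2\\ v_1,v_2,v_3\end{smallmatrix}\Big|\,z\right]=\sum_{n\ge0}\frac{(u_1)_n(u_2)_n}{n!\,(v_1)_n(v_2)_n(v_3)_n}z^n$ with $(u)_n=u(u+1)\cdots(u+n-1)$, and $J_\alpha(t)=\sum_{n\ge0}\frac{(-1)^n}{n!\,\Gamma(n+\alpha+1)}(t/2)^{2n+\alpha}$ is the Bessel function of the first kind of real order $\alpha$. **(A)** Let $a>0$, $b>0$, $c>-1$ be real numbers satisfying one of the following conditions: (i) $-1<c\le-\tfrac12$, $\;a\le\min(c+1,\,b+c)$ and $b\ge\tfrac14$; (ii) $c\ge-\tfrac12$, $\;b\ge\tfrac14$, and either $$a\le\min\left(\tfrac12,\;b+\tfrac c2-\tfrac14\right)$$ or $$\tfrac12\le a\le\min\left(c+1,\;b+c,\;b+\tfrac c2+\tfrac14,\;\tfrac b2+\tfrac{3c}4+\tfrac38,\;2b+\tfrac c2-\tfrac14\right).$$ Then $${}_2F_3\left[\begin{matrix}a,\;a+\tfrac12\\ c+1,\;a+b,\;a+b+\tfrac12\end{matrix}\;\Big|\;-x^2\right]\ge0\qquad\text{for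 all }x>0.$$ The inequality is strict for every $x>0$ unless $(a,b,c)=(\tfrac12,1,-\tfrac12)$ or $(a,b,c)=(1,\tfrac12,\tfrac12)$; in these two cases the function vanishes at some $x>0$. **(B)** Let $\alpha>-1$ and let $\lambda,\mu$ be real numbers satisfying one of the following conditions: (i) $-1<\alpha\le-\tfrac12$, $\;\lambda\ge-\tfrac12$ and $-\alpha-1<\mu\le\min(\alpha+1,\,\lambda+\alpha)$; (ii) $\alpha\ge-\tfrac12$, $\;\lambda\ge-\tfrac12$, and either $$-\alpha-1<\mu\le\min\left(-\alpha,\;\lambda-\tfrac12\right)$$ or $$-\alpha\le\mu\le\min\left(\alpha+1,\;\lambda+\alpha,\;\lambda+\tfrac12,\;2\lambda+\tfrac12,\;\tfrac12\left(\lambda+\alpha+\tfrac12\right)\right).$$ Then, for every $x>0$, the integral below converges absolutely and $$\int_0^x(x-t)^\lambda\,t^\mu J_\alpha(t)\,dt\ge0 .$$ The inequality is strict for every $x>0$ unless $(\alpha,\lambda,\mu)=(-\tfrac12,1,\tfrac12)$ or $(\alpha,\lambda,\mu)=(\tfrac12,0,\tfrac12)$. In both exceptional cases, for every $x>0$, the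 integral equals $$\sqrt{\tfrac2\pi}\int_0^x(x-t)\cos t\,dt=\sqrt{\tfrac2\pi}\int_0^x\sin t\,dt=2\sqrt{\tfrac2\pi}\,\sin^2\left(\tfrac x2\right).$$ -/

import Mathlib

noncomputable section

/-- The Pochhammer symbol `(u)_n = u (u + 1) ⋯ (u + n - 1)`, with `(u)_0 = 1`. -/
abbrev poch (u : ℝ) (n : ℕ) : ℝ := (ascPochhammer ℝ n).eval u

/-- The generalized hypergeometric series `₂F₃[u₁, u₂; v₁, v₂, v₃ | z]` with real parameters, at a
real argument `z`. -/
def hypergeometric23 (u₁ u₂ v₁ v₂ v₃ z : ℝ) : ℝ :=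
  ∑' n : ℕ, poch u₁ n * poch u₂ n /
    ((n.factorial : ℝ) * (poch v₁ n * poch v₂ n * poch v₃ n)) * z ^ n

/-- The Bessel function of the first kind of real order `ν`, at a positive argument `x`:
`J_ν(x) = ∑ (-1)ⁿ / (n! Γ(n + ν + 1)) (x / 2)^(2 n + ν)`. -/
def besselJ (ν x : ℝ) : ℝ :=
  ∑' n : ℕ, (-1 : ℝ) ^ n / ((n.factorial : ℝ) * Real.Gamma (n + ν + 1)) *
    (x / 2) ^ (2 * (n : ℝ) + ν)

/-- The integrand `(x - t)^λ t^μ J_α(t)`, for `0 < t < x`. -/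
def besselIntegrand (α lam μ x t : ℝ) : ℝ := (x - t) ^ lam * t ^ μ * besselJ α t

/-- The fractional integral `∫₀ˣ (x - t)^λ t^μ J_α(t) dt`. -/
def besselIntegral (α lam μ x : ℝ) : ℝ := ∫ t in (0 : ℝ)..x, besselIntegrand α lam μ x t

end

/-!
Consider entire series `f(y) = ∑ t_k (-y)^k` with `f(0) > 0` and `f ≥ 0` on `(0, ∞)`. Dividing `t_k`
by `u + k` replaces `f(y)` by `∫₀¹ σ^(u-1) f(σ y) dσ`, which is positive for `y > 0`. If the pair
`(u₁, u₂)` weakly supermajorizes `(v₁, v₂)`, the partial fractions of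
`(v₁ + k)(v₂ + k) / ((u₁ + k)(u₂ + k))` have nonnegative coefficients, so multiplying `t_k` by this
quotient preserves nonnegativity. An infinite product of such quotients shows the same for
multiplication by `(u₁)_k (u₂)_k / ((v₁)_k (v₂)_k)`, with strict positivity unless
`{u₁, u₂} = {v₁, v₂}`.

The square of a Bessel function is a nonnegative `₁F₂` series, and in each part of the parameter
region two such multiplications lead from it to the `₂F₃` series. Integrating the Bessel series
termwise against `(x - t)^λ t^μ` turns part (B) into part (A).
-/

open MeasureTheory Filter Topology
open Set hiding antidiagonal mem_antidiagonal
open ProbabilityTheory (beta beta_pos)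
open Finset.HasAntidiagonal (antidiagonal mem_antidiagonal)

/-- The power series with coefficients `t` has infinite radius of convergence. -/
def EntireCoeff (t : ℕ → ℝ) : Prop := ∀ r : ℝ, 0 ≤ r → Summable fun k => |t k| * r ^ k

/-- The sum of the power series with coefficients `t` at `-y`. The sign is built in because all
functions below are studied on the negative half-line. -/
noncomputable def altSeries (t : ℕ → ℝ) (y : ℝ) : ℝ := ∑' k, t k * (-y) ^ k

/-- The cone of coefficient sequences whose power series is entire, positive at `0` and nonnegative
on the negative half-line. -/
structure AltNonneg (t : ℕ → ℝ) : Prop where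
  entire : EntireCoeff t
  zero_pos : 0 < t 0
  nonneg : ∀ y, 0 < y → 0 ≤ altSeries t y

section Series

variable {s t : ℕ → ℝ} {u y : ℝ}

theorem EntireCoeff.of_le (ht : EntireCoeff t) (C : ℝ) (h : ∀ k, |s k| ≤ C * |t k|) :
    EntireCoeff s := fun r hr => by
  refine Summable.of_nonneg_of_le (fun k => by positivity) (fun k => ?_) ((ht r hr).mul_left C)
  rw [← mul_assoc]
  exact mul_le_mul_of_nonneg_right (h k) (pow_nonneg hr k)

theorem EntireCoeff.of_le_pow_div_factorial (M : ℝ) (h : ∀ k, |t k| ≤ M ^ k / k.factorial) :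
    EntireCoeff t := fun r hr => by
  refine Summable.of_nonneg_of_le (fun k => by positivity) (fun k => ?_)
    (Real.summable_pow_div_factorial (M * r))
  rw [mul_pow, mul_div_right_comm]
  exact mul_le_mul_of_nonneg_right (h k) (pow_nonneg hr k)

theorem EntireCoeff.summable_norm (ht : EntireCoeff t) (y : ℝ) :
    Summable fun k => ‖t k * (-y) ^ k‖ := by
  simpa using ht |y| (abs_nonneg y)

theorem EntireCoeff.summable (ht : EntireCoeff t) (y : ℝ) : Summable fun k => t k * (-y) ^ k :=
  (ht.summable_norm y).of_norm

theorem EntireCoeff.continuous_altSeries (ht : EntireCoeff t) : Continuous (altSeries t) := by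
  refine continuous_iff_continuousAt.2 fun y => ?_
  have h : ContinuousOn (altSeries t) (Icc (-(|y| + 1)) (|y| + 1)) := by
    refine continuousOn_tsum (u := fun k => |t k| * (|y| + 1) ^ k) (fun k => by fun_prop)
      (ht _ (by positivity)) fun k x hx => ?_
    rw [norm_mul, norm_pow, norm_neg, Real.norm_eq_abs, Real.norm_eq_abs]
    gcongr
    exact abs_le.2 hx
  exact h.continuousAt (Icc_mem_nhds (by linarith [neg_abs_le y]) (by linarith [le_abs_self y]))

theorem altSeries_zero (t : ℕ → ℝ) : altSeries t 0 = t 0 := by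
  rw [altSeries, tsum_eq_single 0 fun k hk => by simp [hk]]
  simp

theorem EntireCoeff.altSeries_mul (hs : EntireCoeff s) (ht : EntireCoeff t) (y : ℝ) :
    altSeries s y * altSeries t y =
      altSeries (fun k => ∑ p ∈ antidiagonal k, s p.1 * t p.2) y := by
  simp only [altSeries]
  rw [tsum_mul_tsum_eq_tsum_sum_antidiagonal_of_summable_norm (hs.summable_norm y)
    (ht.summable_norm y)]
  refine tsum_congr fun k => ?_
  rw [Finset.sum_mul]
  refine Finset.sum_congr rfl fun p hp => ?_
  rw [← mem_antidiagonal.1 hp, pow_add]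
  ring

theorem EntireCoeff.hasSum_integral_mul_altSeries (ht : EntireCoeff t) {a b : ℝ} {w g : ℝ → ℝ}
    (hw : IntervalIntegrable w volume a b) (hg : Continuous g) :
    HasSum (fun k => t k * ((-1) ^ k * ∫ σ in a..b, w σ * g σ ^ k))
      (∫ σ in a..b, w σ * altSeries t (g σ)) := by
  obtain ⟨R, hR⟩ := (isCompact_uIcc (a := a) (b := b)).exists_bound_of_continuousOn hg.continuousOn
  have hR₀ : 0 ≤ R := (norm_nonneg _).trans (hR a left_mem_uIcc)
  have hterm (k : ℕ) : ∫ σ in a..b, w σ * (t k * (-g σ) ^ k) =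
      t k * ((-1) ^ k * ∫ σ in a..b, w σ * g σ ^ k) := by
    rw [← intervalIntegral.integral_const_mul, ← intervalIntegral.integral_const_mul]
    refine intervalIntegral.integral_congr fun σ _ => ?_
    simp only [neg_pow (g σ)]
    ring
  simp only [← hterm]
  refine intervalIntegral.hasSum_integral_of_dominated_convergence
    (fun k σ => |t k| * R ^ k * ‖w σ‖) (fun k => ?_) (fun k => .of_forall fun σ hσ => ?_)
    (.of_forall fun σ _ => (ht R hR₀).mul_right _) ?_
    (.of_forall fun σ _ => (ht.summable (g σ)).hasSum.mul_left _)
  · exact hw.def'.aestronglyMeasurable.mul (by fun_prop : Continuous _).aestronglyMeasurable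
  · rw [norm_mul, norm_mul, norm_pow, norm_neg, Real.norm_eq_abs (t k), mul_comm]
    gcongr
    exact hR σ (uIoc_subset_uIcc hσ)
  · simp only [tsum_mul_right]
    exact hw.norm.const_mul _

theorem EntireCoeff.div_add (ht : EntireCoeff t) (hu : 0 < u) :
    EntireCoeff fun k => t k / (u + k) := by
  refine ht.of_le u⁻¹ fun k => ?_
  rw [abs_div, abs_of_pos (by positivity : 0 < u + k), div_eq_inv_mul]
  gcongr
  simp

theorem EntireCoeff.integral_rpow_mul_altSeries (ht : EntireCoeff t) (hu : 0 < u) (y : ℝ) :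
    ∫ σ in (0 : ℝ)..1, σ ^ (u - 1) * altSeries t (σ * y) =
      altSeries (fun k => t k / (u + k)) y := by
  have hmoment (k : ℕ) : ∫ σ in (0 : ℝ)..1, σ ^ (u - 1) * (σ * y) ^ k = y ^ k / (u + k) := by
    have hk : 0 < u + k := by positivity
    calc ∫ σ in (0 : ℝ)..1, σ ^ (u - 1) * (σ * y) ^ k
        = ∫ σ in (0 : ℝ)..1, y ^ k * σ ^ (u + k - 1) := by
          refine intervalIntegral.integral_congr_ae (.of_forall fun σ hσ => ?_)
          rw [uIoc_of_le zero_le_one] at hσ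
          rw [add_sub_right_comm, Real.rpow_add hσ.1, Real.rpow_natCast, mul_pow]
          ring
      _ = y ^ k / (u + k) := by
          rw [intervalIntegral.integral_const_mul, integral_rpow (Or.inl (by linarith))]
          simp [Real.zero_rpow hk.ne', div_eq_mul_inv]
  refine (ht.hasSum_integral_mul_altSeries (g := (· * y))
    (intervalIntegral.intervalIntegrable_rpow' (by linarith)) (by fun_prop)).unique ?_
  simp only [hmoment]
  convert! ((ht.div_add hu).summable y).hasSum using 2 with k
  rw [neg_pow y]
  ring

theorem AltNonneg.altSeries_div_add_pos (ht : AltNonneg t) (hu : 0 < u) (hy : 0 < y) :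
    0 < altSeries (fun k => t k / (u + k)) y := by
  have hcont : Continuous fun σ => altSeries t (σ * y) :=
    ht.entire.continuous_altSeries.comp (continuous_mul_const y)
  have hint (p q : ℝ) :
      IntervalIntegrable (fun σ => σ ^ (u - 1) * altSeries t (σ * y)) volume p q :=
    (intervalIntegral.intervalIntegrable_rpow' (by linarith)).mul_continuousOn hcont.continuousOn
  obtain ⟨ε, hε, hpos⟩ : ∃ ε > 0, ∀ σ ∈ Ico 0 ε, 0 < altSeries t (σ * y) := by
    have : ∀ᶠ σ in 𝓝[≥] 0, 0 < altSeries t (σ * y) :=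
      (hcont.tendsto 0).eventually_const_lt (by simpa [altSeries_zero] using ht.zero_pos)
        |>.filter_mono nhdsWithin_le_nhds
    obtain ⟨ε, hε, h⟩ := mem_nhdsGE_iff_exists_Ico_subset.1 this
    exact ⟨ε, hε, h⟩
  have hδ : 0 < min ε 1 := lt_min hε one_pos
  rw [← ht.entire.integral_rpow_mul_altSeries hu, ← intervalIntegral.integral_add_adjacent_intervals
    (hint 0 (min ε 1)) (hint (min ε 1) 1)]
  refine add_pos_of_pos_of_nonneg
    (intervalIntegral.intervalIntegral_pos_of_pos_on (hint _ _) (fun σ hσ => ?_) hδ)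
    (intervalIntegral.integral_nonneg (min_le_right _ _) fun σ hσ => ?_)
  · exact mul_pos (Real.rpow_pos_of_pos hσ.1 _)
      (hpos σ ⟨hσ.1.le, hσ.2.trans_le (min_le_left _ _)⟩)
  · have hσ₀ : 0 < σ := hδ.trans_le hσ.1
    exact mul_nonneg (Real.rpow_nonneg hσ₀.le _) (ht.nonneg _ (by positivity))

theorem AltNonneg.div_add (ht : AltNonneg t) (hu : 0 < u) : AltNonneg fun k => t k / (u + k) where
  entire := ht.entire.div_add hu
  zero_pos := by simpa using div_pos ht.zero_pos hu
  nonneg _ hy := (ht.altSeries_div_add_pos hu hy).le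

theorem AltNonneg.of_tendsto {q : ℕ → ℕ → ℝ} (hq : ∀ N, AltNonneg (q N)) (ht : EntireCoeff t)
    (hle : ∀ N k, |q N k| ≤ |t k|) (hlim : ∀ k, Tendsto (fun N => q N k) atTop (𝓝 (s k)))
    (hs : 0 < s 0) : AltNonneg s where
  entire := ht.of_le 1 fun k => by
    rw [one_mul]
    exact le_of_tendsto (hlim k).abs (.of_forall fun N => hle N k)
  zero_pos := hs
  nonneg y hy := by
    have hlim_sum : Tendsto (fun N => altSeries (q N) y) atTop (𝓝 (altSeries s y)) := by
      refine tendsto_tsum_of_dominated_convergence (ht y hy.le)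
        (fun k => (hlim k).mul_const _) (.of_forall fun N k => ?_)
      rw [norm_mul, norm_pow, norm_neg, Real.norm_eq_abs, Real.norm_of_nonneg hy.le]
      exact mul_le_mul_of_nonneg_right (hle N k) (by positivity)
    exact ge_of_tendsto hlim_sum (.of_forall fun N => (hq N).nonneg y hy)

end Series

section Pochhammer

variable {u v : ℝ}

@[simp]
theorem poch_zero (u : ℝ) : poch u 0 = 1 := by simp [poch]

theorem poch_succ (u : ℝ) (n : ℕ) : poch u (n + 1) = poch u n * (u + n) :=
  ascPochhammer_succ_eval n u

theorem poch_pos (hu : 0 < u) (n : ℕ) : 0 < poch u n := ascPochhammer_pos n u hu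

theorem poch_add (u : ℝ) (m n : ℕ) : poch u (m + n) = poch u m * poch (u + m) n := by
  simp [poch, ← ascPochhammer_mul]

theorem mul_poch_add_one (u : ℝ) (n : ℕ) : u * poch (u + 1) n = poch u n * (u + n) := by
  simpa [poch_succ, add_comm 1 n] using (poch_add u 1 n).symm

theorem poch_two_mul (u : ℝ) (n : ℕ) :
    poch (2 * u) (2 * n) = 4 ^ n * (poch u n * poch (u + 1 / 2) n) := by
  induction n with
  | zero => simp
  | succ n ih =>
    rw [mul_add_one 2 n, poch_succ, poch_succ, ih, poch_succ, poch_succ]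
    push_cast
    ring

theorem poch_le_poch (hu : 0 < u) (huv : u ≤ v) (n : ℕ) : poch u n ≤ poch v n := by
  induction n with
  | zero => simp
  | succ n ih =>
    have := poch_pos (hu.trans_le huv) n
    rw [poch_succ, poch_succ]
    gcongr

theorem pow_min_one_le_poch (hu : 0 < u) (n : ℕ) : min u 1 ^ n ≤ poch u n := by
  induction n with
  | zero => simp
  | succ n ih =>
    have := poch_pos hu n
    rw [pow_succ, poch_succ]
    gcongr
    exact (min_le_left u 1).trans (by simp)

theorem Gamma_natCast_add (hu : 0 < u) (n : ℕ) :
    Real.Gamma (n + u) = poch u n * Real.Gamma u := by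
  induction n with
  | zero => simp
  | succ n ih =>
    rw [Nat.cast_add_one, add_right_comm, Real.Gamma_add_one (by positivity), ih, poch_succ]
    ring

/-- The quotients of Pochhammer symbols `(u)_k / (v)_k`, as a sequence in `k`. -/
noncomputable def pochRatio (u v : ℝ) : ℕ → ℝ := fun k => poch u k / poch v k

/-- The factor `u (v + k) / (v (u + k))` by which `pochRatio u v` exceeds
`pochRatio (u + 1) (v + 1)`, as a sequence in `k`. -/
noncomputable def shiftFactor (u v : ℝ) : ℕ → ℝ := fun k => u * (v + k) / (v * (u + k))

@[simp]
theorem pochRatio_zero (u v : ℝ) : pochRatio u v 0 = 1 := by simp [pochRatio]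

theorem pochRatio_pos (hu : 0 < u) (hv : 0 < v) (k : ℕ) : 0 < pochRatio u v k :=
  div_pos (poch_pos hu k) (poch_pos hv k)

theorem pochRatio_self (hu : 0 < u) : pochRatio u u = 1 :=
  funext fun k => div_self (poch_pos hu k).ne'

theorem pochRatio_mul_pochRatio (u w : ℝ) (hv : 0 < v) :
    pochRatio u v * pochRatio v w = pochRatio u w :=
  funext fun k => div_mul_div_cancel₀ (poch_pos hv k).ne'

theorem pochRatio_le_one (hu : 0 < u) (huv : u ≤ v) (k : ℕ) : pochRatio u v k ≤ 1 :=
  div_le_one_of_le₀ (poch_le_poch hu huv k) (poch_pos (hu.trans_le huv) k).le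

theorem shiftFactor_zero (hu : 0 < u) (hv : 0 < v) : shiftFactor u v 0 = 1 := by
  have : 0 < v * u := by positivity
  simp [shiftFactor, mul_comm u v, this.ne']

theorem shiftFactor_mul_pochRatio (hu : 0 < u) (hv : 0 < v) :
    shiftFactor u v * pochRatio (u + 1) (v + 1) = pochRatio u v := by
  ext k
  have := poch_pos hv k
  have := poch_pos (by linarith : 0 < v + 1) k
  have hu' := mul_poch_add_one u k
  have hv' := mul_poch_add_one v k
  rw [Pi.mul_apply, shiftFactor, pochRatio, pochRatio, div_mul_div_comm,
    div_eq_div_iff (by positivity) (by positivity)]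
  linear_combination (v + k) * poch v k * hu' - poch u k * (u + k) * hv'

theorem prod_shiftFactor_mul_pochRatio (hu : 0 < u) (hv : 0 < v) (N : ℕ) :
    (∏ n ∈ Finset.range N, shiftFactor (u + n) (v + n)) * pochRatio (u + N) (v + N) =
      pochRatio u v := by
  induction N with
  | zero => simp
  | succ N ih =>
    rw [Finset.prod_range_succ, mul_assoc, Nat.cast_add_one, ← add_assoc, ← add_assoc,
      shiftFactor_mul_pochRatio (by positivity) (by positivity), ih]

theorem tendsto_pochRatio_add_natCast (u v : ℝ) (k : ℕ) :
    Tendsto (fun N : ℕ => pochRatio (u + N) (v + N) k) atTop (𝓝 1) := by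
  induction k with
  | zero => simp [pochRatio]
  | succ k ih =>
    have hfactor := tendsto_add_mul_div_add_mul_atTop_nhds (u + k) (v + k) (1 : ℝ) one_ne_zero
    simpa [pochRatio, poch_succ, div_mul_div_comm, add_right_comm] using ih.mul hfactor

theorem tendsto_prod_shiftFactor (hu : 0 < u) (hv : 0 < v) (k : ℕ) :
    Tendsto (fun N => ∏ n ∈ Finset.range N, shiftFactor (u + n) (v + n) k) atTop
      (𝓝 (pochRatio u v k)) := by
  have h := (tendsto_const_nhds (x := pochRatio u v k)).div
    (tendsto_pochRatio_add_natCast u v k) one_ne_zero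
  rw [div_one] at h
  refine h.congr fun N => ?_
  have hN : pochRatio (u + N) (v + N) k ≠ 0 :=
    (pochRatio_pos (by positivity) (by positivity) k).ne'
  simp [← prod_shiftFactor_mul_pochRatio hu hv N, hN]

end Pochhammer

/-- The positive pair `(u₁, u₂)` weakly supermajorizes `(v₁, v₂)`: the smallest entry and the sum
of the former are at most those of the latter. The first entry `u₁` takes the role of the
smallest. -/
structure WeaklySupermajorizes (u₁ u₂ v₁ v₂ : ℝ) : Prop where
  pos_left : 0 < u₁
  pos_right : 0 < u₂
  le_left : u₁ ≤ v₁
  le_right : u₁ ≤ v₂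
  add_le_add : u₁ + u₂ ≤ v₁ + v₂

section WeakMajorization

variable {u₁ u₂ v₁ v₂ y : ℝ} {t : ℕ → ℝ}

theorem WeaklySupermajorizes.pos_left' (h : WeaklySupermajorizes u₁ u₂ v₁ v₂) : 0 < v₁ :=
  h.pos_left.trans_le h.le_left

theorem WeaklySupermajorizes.pos_right' (h : WeaklySupermajorizes u₁ u₂ v₁ v₂) : 0 < v₂ :=
  h.pos_left.trans_le h.le_right

theorem WeaklySupermajorizes.add_natCast (h : WeaklySupermajorizes u₁ u₂ v₁ v₂) (n : ℕ) :
    WeaklySupermajorizes (u₁ + n) (u₂ + n) (v₁ + n) (v₂ + n) where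
  pos_left := by linarith [h.pos_left, n.cast_nonneg (α := ℝ)]
  pos_right := by linarith [h.pos_right, n.cast_nonneg (α := ℝ)]
  le_left := by linarith [h.le_left]
  le_right := by linarith [h.le_right]
  add_le_add := by linarith [h.add_le_add]

theorem WeaklySupermajorizes.lt_or_lt (h : WeaklySupermajorizes u₁ u₂ v₁ v₂)
    (hne : s(u₁, u₂) ≠ s(v₁, v₂)) : u₁ + u₂ < v₁ + v₂ ∨ (u₁ < v₁ ∧ u₁ < v₂) := by
  by_contra! hcon
  have hsum : u₁ + u₂ = v₁ + v₂ := h.add_le_add.antisymm hcon.1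
  refine hne (Sym2.eq_iff.2 ?_)
  rcases h.le_left.eq_or_lt with heq | hlt
  · exact Or.inl ⟨heq, by linarith⟩
  · have heq : u₁ = v₂ := h.le_right.antisymm (hcon.2 hlt)
    exact Or.inr ⟨heq, by linarith⟩

theorem WeaklySupermajorizes.shiftFactor_mul_nonneg (h : WeaklySupermajorizes u₁ u₂ v₁ v₂) (k : ℕ) :
    0 ≤ shiftFactor u₁ v₁ k * shiftFactor u₂ v₂ k := by
  have := h.pos_left
  have := h.pos_right
  have := h.pos_left'
  have := h.pos_right'
  unfold shiftFactor
  positivity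

theorem WeaklySupermajorizes.shiftFactor_mul_le_one (h : WeaklySupermajorizes u₁ u₂ v₁ v₂)
    (k : ℕ) : shiftFactor u₁ v₁ k * shiftFactor u₂ v₂ k ≤ 1 := by
  have hu₁ := h.pos_left
  have hu₂ := h.pos_right
  have := h.pos_left'
  have := h.pos_right'
  have hδ : 0 ≤ v₁ + v₂ - (u₁ + u₂) := sub_nonneg.2 h.add_le_add
  have hd : 0 ≤ (v₁ - u₁) * (v₂ - u₁) :=
    mul_nonneg (sub_nonneg.2 h.le_left) (sub_nonneg.2 h.le_right)
  rw [shiftFactor, shiftFactor, div_mul_div_comm, div_le_one (by positivity), ← sub_nonneg]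
  calc 0 ≤ k ^ 2 * (u₁ * (v₁ + v₂ - (u₁ + u₂)) + (v₁ - u₁) * (v₂ - u₁)) +
        k * (u₁ ^ 2 * (v₁ + v₂ - (u₁ + u₂)) + (u₁ + u₂) * ((v₁ - u₁) * (v₂ - u₁))) := by
        positivity
    _ = v₁ * (u₁ + k) * (v₂ * (u₂ + k)) - u₁ * (v₁ + k) * (u₂ * (v₂ + k)) := by ring

theorem EntireCoeff.mul_shiftFactor (ht : EntireCoeff t) (h : WeaklySupermajorizes u₁ u₂ v₁ v₂) :
    EntireCoeff (t * (shiftFactor u₁ v₁ * shiftFactor u₂ v₂)) := by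
  refine ht.of_le 1 fun k => ?_
  rw [one_mul, Pi.mul_apply, abs_mul, Pi.mul_apply, abs_of_nonneg (h.shiftFactor_mul_nonneg k)]
  exact mul_le_of_le_one_right (abs_nonneg _) (h.shiftFactor_mul_le_one k)

-- The partial fractions of `(v₁ + k)(v₂ + k) / ((u₁ + k)(u₂ + k))`, applied termwise.
theorem EntireCoeff.altSeries_mul_shiftFactor (ht : EntireCoeff t)
    (h : WeaklySupermajorizes u₁ u₂ v₁ v₂) (y : ℝ) :
    altSeries (t * (shiftFactor u₁ v₁ * shiftFactor u₂ v₂)) y = u₁ * u₂ / (v₁ * v₂) *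
      (altSeries t y + (v₁ + v₂ - (u₁ + u₂)) * altSeries (fun k => t k / (u₂ + k)) y +
        (v₁ - u₁) * (v₂ - u₁) * altSeries (fun k => t k / (u₂ + k) / (u₁ + k)) y) := by
  have hu₁ := h.pos_left
  have hu₂ := h.pos_right
  have hv₁ := h.pos_left'
  have hv₂ := h.pos_right'
  have hsum := (((ht.summable y).hasSum.add
    (((ht.div_add hu₂).summable y).hasSum.mul_left (v₁ + v₂ - (u₁ + u₂)))).add
    ((((ht.div_add hu₂).div_add hu₁).summable y).hasSum.mul_left ((v₁ - u₁) * (v₂ - u₁)))).mul_left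
    (u₁ * u₂ / (v₁ * v₂))
  refine Eq.trans (tsum_congr fun k => ?_) hsum.tsum_eq
  simp only [Pi.mul_apply, shiftFactor]
  field_simp
  ring

theorem AltNonneg.mul_shiftFactor (ht : AltNonneg t) (h : WeaklySupermajorizes u₁ u₂ v₁ v₂) :
    AltNonneg (t * (shiftFactor u₁ v₁ * shiftFactor u₂ v₂)) where
  entire := ht.entire.mul_shiftFactor h
  zero_pos := by
    simpa [shiftFactor_zero h.pos_left h.pos_left', shiftFactor_zero h.pos_right h.pos_right']
      using ht.zero_pos
  nonneg y hy := by
    rw [ht.entire.altSeries_mul_shiftFactor h]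
    have := h.pos_left
    have := h.pos_right
    have := h.pos_left'
    have := h.pos_right'
    have := sub_nonneg.2 h.le_left
    have := sub_nonneg.2 h.le_right
    have := sub_nonneg.2 h.add_le_add
    have := ht.nonneg y hy
    have := (ht.div_add h.pos_right).nonneg y hy
    have := ((ht.div_add h.pos_right).div_add h.pos_left).nonneg y hy
    positivity

theorem AltNonneg.altSeries_mul_shiftFactor_pos (ht : AltNonneg t)
    (h : WeaklySupermajorizes u₁ u₂ v₁ v₂) (hne : s(u₁, u₂) ≠ s(v₁, v₂)) (hy : 0 < y) :
    0 < altSeries (t * (shiftFactor u₁ v₁ * shiftFactor u₂ v₂)) y := by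
  rw [ht.entire.altSeries_mul_shiftFactor h]
  have := h.pos_left
  have := h.pos_right
  have := h.pos_left'
  have := h.pos_right'
  have := sub_nonneg.2 h.le_left
  have := sub_nonneg.2 h.le_right
  have := sub_nonneg.2 h.add_le_add
  have := ht.nonneg y hy
  have := ht.altSeries_div_add_pos h.pos_right hy
  have := (ht.div_add h.pos_right).altSeries_div_add_pos h.pos_left hy
  rcases h.lt_or_lt hne with hlt | ⟨hlt₁, hlt₂⟩
  · have := sub_pos.2 hlt
    positivity
  · have := sub_pos.2 hlt₁
    have := sub_pos.2 hlt₂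
    positivity

theorem AltNonneg.mul_pochRatio (ht : AltNonneg t) (h : WeaklySupermajorizes u₁ u₂ v₁ v₂) :
    AltNonneg (t * (pochRatio u₁ v₁ * pochRatio u₂ v₂)) := by
  let P (N : ℕ) : ℕ → ℝ := ∏ n ∈ Finset.range N,
    (shiftFactor (u₁ + n) (v₁ + n) * shiftFactor (u₂ + n) (v₂ + n))
  have hP (N k : ℕ) : |P N k| ≤ 1 := by
    simp only [P, Finset.prod_apply, Finset.abs_prod]
    refine Finset.prod_le_one (fun _ _ => abs_nonneg _) fun n _ => ?_
    rw [Pi.mul_apply, abs_of_nonneg ((h.add_natCast n).shiftFactor_mul_nonneg k)]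
    exact (h.add_natCast n).shiftFactor_mul_le_one k
  have hnonneg (N : ℕ) : AltNonneg (t * P N) := by
    induction N with
    | zero => simpa [P] using ht
    | succ N ih =>
      simpa only [P, Finset.prod_range_succ, mul_assoc] using ih.mul_shiftFactor (h.add_natCast N)
  refine .of_tendsto hnonneg ht.entire (fun N k => ?_) (fun k => ?_) ?_
  · rw [Pi.mul_apply, abs_mul]
    exact mul_le_of_le_one_right (abs_nonneg _) (hP N k)
  · simpa [P, Finset.prod_mul_distrib] using
      ((tendsto_prod_shiftFactor h.pos_left h.pos_left' k).mul
        (tendsto_prod_shiftFactor h.pos_right h.pos_right' k)).const_mul (t k)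
  · simpa [pochRatio_zero] using ht.zero_pos

theorem AltNonneg.altSeries_mul_pochRatio_pos (ht : AltNonneg t)
    (h : WeaklySupermajorizes u₁ u₂ v₁ v₂) (hne : s(u₁, u₂) ≠ s(v₁, v₂)) (hy : 0 < y) :
    0 < altSeries (t * (pochRatio u₁ v₁ * pochRatio u₂ v₂)) y := by
  have hshift := ht.mul_pochRatio (by simpa using h.add_natCast 1)
  convert! hshift.altSeries_mul_shiftFactor_pos h hne hy using 1
  rw [← shiftFactor_mul_pochRatio h.pos_left h.pos_left',
    ← shiftFactor_mul_pochRatio h.pos_right h.pos_right']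
  congr 1
  ring

theorem pochRatio_mul_pochRatio_eq_one (hu₁ : 0 < u₁) (hu₂ : 0 < u₂)
    (h : s(u₁, u₂) = s(v₁, v₂)) : pochRatio u₁ v₁ * pochRatio u₂ v₂ = 1 := by
  rcases Sym2.eq_iff.1 h with ⟨rfl, rfl⟩ | ⟨rfl, rfl⟩
  · rw [pochRatio_self hu₁, pochRatio_self hu₂, mul_one]
  · rw [pochRatio_mul_pochRatio _ _ hu₂, pochRatio_self hu₁]

end WeakMajorization

/-- The coefficients of the confluent hypergeometric limit function `₀F₁(c; z)`. For `c = ν + 1`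
this is the Bessel function `J_ν` up to a power factor and the substitution `z = -(x / 2)²`. -/
noncomputable def zeroFOneCoeff (c : ℝ) : ℕ → ℝ := fun k => 1 / (k.factorial * poch c k)

/-- The coefficients of `₁F₂(A; 2 A, A + 1/2; z)`, which is the square of `₀F₁(A + 1/2; z / 4)`. -/
noncomputable def besselSqCoeff (A : ℝ) : ℕ → ℝ := zeroFOneCoeff (2 * A) * pochRatio A (A + 1 / 2)

section BesselSquare

variable {c A : ℝ}

theorem entireCoeff_zeroFOneCoeff (hc : 0 < c) : EntireCoeff (zeroFOneCoeff c) := by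
  have : 0 < min c 1 := lt_min hc one_pos
  refine .of_le_pow_div_factorial (min c 1)⁻¹ fun k => ?_
  have := poch_pos hc k
  rw [zeroFOneCoeff, abs_of_pos (by positivity), inv_pow, inv_eq_one_div, div_div, mul_comm]
  gcongr
  exact pow_min_one_le_poch hc k

theorem ringChoose_eq_poch_div (r : ℝ) (n : ℕ) :
    Ring.choose r n = poch (r - n + 1) n / n.factorial := by
  rw [Ring.choose_eq_smul, ← Polynomial.aeval_eq_smeval, poch,
    ← descPochhammer_eval_eq_ascPochhammer, ← descPochhammer_map (Int.castRingHom ℝ),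
    Polynomial.eval_map, Polynomial.aeval_def, smul_eq_mul, div_eq_inv_mul]
  rfl

-- The Chu–Vandermonde identity for `2 (c + k - 1)` choose `k`.
theorem sum_antidiagonal_zeroFOneCoeff_mul (hc : 0 < c) (k : ℕ) :
    ∑ p ∈ antidiagonal k, zeroFOneCoeff c p.1 * zeroFOneCoeff c p.2 =
      poch (2 * c - 1 + k) k / (k.factorial * poch c k ^ 2) := by
  have hsplit {i j : ℕ} (hij : i + j = k) :
      Ring.choose (c + k - 1) i = poch c k / (poch c j * i.factorial) := by
    rw [ringChoose_eq_poch_div, ← hij, add_comm i j, poch_add,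
      mul_div_mul_left _ _ (poch_pos hc j).ne', Nat.cast_add]
    congr 2
    ring
  have hchoose : poch (2 * c - 1 + k) k / k.factorial =
      ∑ p ∈ antidiagonal k, Ring.choose (c + k - 1) p.1 * Ring.choose (c + k - 1) p.2 := by
    rw [← Ring.add_choose_eq k (Commute.all _ _), ringChoose_eq_poch_div]
    congr 2
    ring
  rw [← div_div, hchoose, Finset.sum_div]
  refine Finset.sum_congr rfl fun p hp => ?_
  rw [mem_antidiagonal] at hp
  have := (poch_pos hc k).ne'
  rw [hsplit hp, hsplit ((add_comm _ _).trans hp)]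
  simp only [zeroFOneCoeff]
  field_simp

theorem besselSqCoeff_mul_four_pow (hA : 0 < A) (k : ℕ) :
    besselSqCoeff A k * 4 ^ k =
      ∑ p ∈ antidiagonal k, zeroFOneCoeff (A + 1 / 2) p.1 * zeroFOneCoeff (A + 1 / 2) p.2 := by
  have hdup : 4 ^ k * (poch A k * poch (A + 1 / 2) k) = poch (2 * A) k * poch (2 * A + k) k := by
    rw [← poch_two_mul, two_mul k, poch_add]
  have := (poch_pos (by linarith : 0 < 2 * A) k).ne'
  have := (poch_pos (by linarith : 0 < A + 1 / 2) k).ne'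
  rw [sum_antidiagonal_zeroFOneCoeff_mul (by linarith), besselSqCoeff, Pi.mul_apply, zeroFOneCoeff,
    pochRatio, mul_add, mul_one_div_cancel two_ne_zero, add_sub_cancel_right, div_mul_div_comm,
    div_mul_eq_mul_div, div_eq_div_iff (by positivity) (by positivity)]
  linear_combination (k.factorial * poch (A + 1 / 2) k) * hdup

theorem altSeries_besselSqCoeff (hA : 0 < A) (y : ℝ) :
    altSeries (besselSqCoeff A) (4 * y) = altSeries (zeroFOneCoeff (A + 1 / 2)) y ^ 2 := by
  have hent := entireCoeff_zeroFOneCoeff (by linarith : 0 < A + 1 / 2)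
  rw [sq, hent.altSeries_mul hent]
  refine tsum_congr fun k => ?_
  simp only [← besselSqCoeff_mul_four_pow hA]
  rw [← mul_neg, mul_pow, mul_assoc]

theorem altNonneg_besselSqCoeff (hA : 0 < A) : AltNonneg (besselSqCoeff A) where
  entire := by
    refine (entireCoeff_zeroFOneCoeff (by linarith : 0 < 2 * A)).of_le 1 fun k => ?_
    have hratio := pochRatio_pos hA (by linarith : 0 < A + 1 / 2) k
    rw [besselSqCoeff, Pi.mul_apply, abs_mul, abs_of_pos hratio, one_mul]
    exact mul_le_of_le_one_right (abs_nonneg _) (pochRatio_le_one hA (by linarith) k)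
  zero_pos := by simp [besselSqCoeff, zeroFOneCoeff]
  nonneg y _ := by
    rw [← mul_div_cancel₀ y four_ne_zero, altSeries_besselSqCoeff hA]
    positivity

end BesselSquare

/-- The coefficients of `₂F₃[a, a + 1/2; c + 1, a + b, a + b + 1/2 | z]`. -/
noncomputable def twoFThreeCoeff (a b c : ℝ) : ℕ → ℝ :=
  zeroFOneCoeff (c + 1) * (pochRatio a (a + b) * pochRatio (a + 1 / 2) (a + b + 1 / 2))

/-- The two parameter triples for which the `₂F₃` series is the square of a Bessel function, hence
has zeros. -/
def IsExceptional (a b c : ℝ) : Prop :=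
  (a = 1 / 2 ∧ b = 1 ∧ c = -1 / 2) ∨ (a = 1 ∧ b = 1 / 2 ∧ c = 1 / 2)

/-- The conclusion of part (A): the `₂F₃` series is nonnegative on the negative half-line, and
positive there unless the parameters are exceptional. -/
structure TwoFThreePositive (a b c : ℝ) : Prop where
  altNonneg : AltNonneg (twoFThreeCoeff a b c)
  pos : ¬IsExceptional a b c → ∀ y, 0 < y → 0 < altSeries (twoFThreeCoeff a b c) y

/-- Condition (i) or (ii) of part (A). -/
def PositivityRegion (a b c : ℝ) : Prop :=
  (c ≤ -1 / 2 ∧ a ≤ min (c + 1) (b + c) ∧ 1 / 4 ≤ b) ∨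
    (-1 / 2 ≤ c ∧ 1 / 4 ≤ b ∧
      (a ≤ min (1 / 2) (b + c / 2 - 1 / 4) ∨
        (1 / 2 ≤ a ∧
          a ≤ min (c + 1) (min (b + c) (min (b + c / 2 + 1 / 4)
            (min (b / 2 + 3 * c / 4 + 3 / 8) (2 * b + c / 2 - 1 / 4)))))))

section TwoFThree

variable {a b b' c x : ℝ}

theorem hypergeometric23_eq_altSeries (a b c x : ℝ) :
    hypergeometric23 a (a + 1 / 2) (c + 1) (a + b) (a + b + 1 / 2) (-x ^ 2) =
      altSeries (twoFThreeCoeff a b c) (x ^ 2) := by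
  refine tsum_congr fun k => ?_
  simp only [twoFThreeCoeff, zeroFOneCoeff, pochRatio, Pi.mul_apply]
  ring

-- The hypothesis `hcoeff` is the identity between coefficients with denominators cleared.
theorem TwoFThreePositive.of_besselSq {A u₁ u₂ v₁ v₂ p₁ p₂ q₁ q₂ : ℝ} (hA : 0 < A)
    (hab : 0 < a + b) (hc : 0 < c + 1) (huv : WeaklySupermajorizes u₁ u₂ v₁ v₂)
    (hpq : WeaklySupermajorizes p₁ p₂ q₁ q₂)
    (hcoeff : ∀ k, poch A k * (poch u₁ k * poch u₂ k) * (poch p₁ k * poch p₂ k) *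
        (poch (c + 1) k * poch (a + b) k * poch (a + b + 1 / 2) k) =
      poch a k * poch (a + 1 / 2) k * (poch (2 * A) k * poch (A + 1 / 2) k *
        (poch v₁ k * poch v₂ k) * (poch q₁ k * poch q₂ k)))
    (hexc : s(u₁, u₂) = s(v₁, v₂) → s(p₁, p₂) = s(q₁, q₂) → IsExceptional a b c) :
    TwoFThreePositive a b c := by
  have hbase := altNonneg_besselSqCoeff hA
  have heq : twoFThreeCoeff a b c = besselSqCoeff A * (pochRatio u₁ v₁ * pochRatio u₂ v₂) *
      (pochRatio p₁ q₁ * pochRatio p₂ q₂) := by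
    ext k
    have := poch_pos hab k
    have := poch_pos (by linarith : 0 < a + b + 1 / 2) k
    have := poch_pos hc k
    have := poch_pos (by linarith : 0 < 2 * A) k
    have := poch_pos (by linarith : 0 < A + 1 / 2) k
    have := poch_pos huv.pos_left' k
    have := poch_pos huv.pos_right' k
    have := poch_pos hpq.pos_left' k
    have := poch_pos hpq.pos_right' k
    simp only [twoFThreeCoeff, besselSqCoeff, zeroFOneCoeff, pochRatio, Pi.mul_apply,
      div_mul_div_comm]
    rw [div_eq_div_iff (by positivity) (by positivity)]
    linear_combination -(k.factorial : ℝ) * hcoeff k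
  constructor <;> rw [heq]
  · exact (hbase.mul_pochRatio huv).mul_pochRatio hpq
  · intro hn y hy
    by_cases hpq' : s(p₁, p₂) = s(q₁, q₂)
    · rw [pochRatio_mul_pochRatio_eq_one hpq.pos_left hpq.pos_right hpq', mul_one]
      exact hbase.altSeries_mul_pochRatio_pos huv (fun huv' => hn (hexc huv' hpq')) hy
    · exact (hbase.mul_pochRatio huv).altSeries_mul_pochRatio_pos hpq hpq' hy

theorem TwoFThreePositive.of_lt (hab : 0 < a + b) (hbb' : b < b') (h : TwoFThreePositive a b c) :
    TwoFThreePositive a b' c := by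
  have hmaj : WeaklySupermajorizes (a + b) (a + b + 1 / 2) (a + b') (a + b' + 1 / 2) := by
    constructor <;> linarith
  have hne : s(a + b, a + b + 1 / 2) ≠ s(a + b', a + b' + 1 / 2) := by
    rw [Ne, Sym2.eq_iff]
    rintro (⟨h, -⟩ | ⟨h, -⟩) <;> linarith
  have heq : twoFThreeCoeff a b' c = twoFThreeCoeff a b c * (pochRatio (a + b) (a + b') *
      pochRatio (a + b + 1 / 2) (a + b' + 1 / 2)) := by
    simp only [twoFThreeCoeff, ← pochRatio_mul_pochRatio a (a + b') hmaj.pos_left,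
      ← pochRatio_mul_pochRatio (a + 1 / 2) (a + b' + 1 / 2) hmaj.pos_right]
    ring
  constructor <;> rw [heq]
  · exact h.altNonneg.mul_pochRatio hmaj
  · exact fun _ y => h.altNonneg.altSeries_mul_pochRatio_pos hmaj hne

theorem TwoFThreePositive.of_le_one (ha : 0 < a) (hb : 1 / 4 ≤ b) (hb₁ : b ≤ 1) (habc : a ≤ b + c)
    (habc' : a ≤ b + c / 2 - 1 / 4) : TwoFThreePositive a b c := by
  refine of_besselSq (A := a + 1 / 2) (u₁ := a) (u₂ := a + 1 / 2 + 1 / 2) (v₁ := a + b)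
    (v₂ := a + 1 - b) (p₁ := a + 1 - b) (p₂ := 2 * (a + 1 / 2)) (q₁ := c + 1)
    (q₂ := a + b + 1 / 2) (by linarith) (by linarith) (by linarith) (by constructor <;> linarith)
    (by constructor <;> linarith) (fun k => by ring) fun huv hpq => ?_
  rcases Sym2.eq_iff.1 huv with ⟨h, -⟩ | ⟨h, -⟩
  · linarith
  · rcases Sym2.eq_iff.1 hpq with ⟨h', h''⟩ | ⟨h', -⟩
    · exact Or.inl ⟨by linarith, by linarith, by linarith⟩
    · linarith

theorem TwoFThreePositive.of_le_half (ha : 1 / 2 ≤ a) (hb : 1 / 4 ≤ b) (hb₁ : b ≤ 1 / 2)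
    (habc : a ≤ b + c) (habc' : a ≤ 2 * b + c / 2 - 1 / 4) : TwoFThreePositive a b c := by
  refine of_besselSq (A := a + 1 / 2 - b) (u₁ := a + 1 / 2 - b + 1 / 2)
    (u₂ := 2 * (a + 1 / 2 - b)) (v₁ := a + b + 1 / 2) (v₂ := c + 1) (p₁ := a) (p₂ := a + 1 / 2)
    (q₁ := a + 1 / 2 - b) (q₂ := a + b) (by linarith) (by linarith) (by linarith)
    (by constructor <;> linarith) (by constructor <;> linarith) (fun k => by ring)
    fun huv hpq => Or.inr ?_
  rcases Sym2.eq_iff.1 hpq with ⟨h, -⟩ | ⟨h, -⟩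
  · rcases Sym2.eq_iff.1 huv with ⟨h', -⟩ | ⟨h', h''⟩
    · linarith
    · exact ⟨by linarith, by linarith, by linarith⟩
  · linarith

theorem TwoFThreePositive.of_half_le (ha : 1 / 2 ≤ a) (hb : 1 / 2 ≤ b) (hc : a - 1 / 2 ≤ c)
    (habc : a ≤ b + c / 2 + 1 / 4) : TwoFThreePositive a b c := by
  obtain ⟨y, hy, hy', hy''⟩ : ∃ y, a + 1 / 2 ≤ y ∧ 2 * a + 1 / 2 - b ≤ y ∧ y ≤ c + b + 1 :=
    ⟨max (a + 1 / 2) (2 * a + 1 / 2 - b), le_max_left _ _, le_max_right _ _,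
      max_le (by linarith) (by linarith)⟩
  refine of_besselSq (A := a) (u₁ := a + 1 / 2) (u₂ := 2 * a) (v₁ := a + b) (v₂ := y)
    (p₁ := a + 1 / 2) (p₂ := y) (q₁ := c + 1) (q₂ := a + b + 1 / 2) (by linarith) (by linarith)
    (by linarith) (by constructor <;> linarith) (by constructor <;> linarith) (fun k => by ring)
    fun huv hpq => Or.inr ?_
  rw [Sym2.eq_iff] at huv hpq
  rcases huv with ⟨h₁, h₂⟩ | ⟨h₁, -⟩ <;> rcases hpq with ⟨h₃, h₄⟩ | ⟨h₃, -⟩ <;>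
    refine ⟨?_, ?_, ?_⟩ <;> linarith

theorem TwoFThreePositive.of_le_sub_half (ha : 1 / 2 ≤ a) (hc : c ≤ a - 1 / 2) (hac : a ≤ c + 1)
    (habc : a ≤ b + c) (habc' : a ≤ b / 2 + 3 * c / 4 + 3 / 8) : TwoFThreePositive a b c := by
  refine of_besselSq (A := 2 * a - c - 1 / 2) (u₁ := 2 * a - c - 1 / 2 + 1 / 2)
    (u₂ := 2 * (2 * a - c - 1 / 2)) (v₁ := a + b) (v₂ := a + b + 1 / 2) (p₁ := a)
    (p₂ := a + 1 / 2) (q₁ := 2 * a - c - 1 / 2) (q₂ := c + 1) (by linarith) (by linarith)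
    (by linarith) (by constructor <;> linarith) (by constructor <;> linarith) (fun k => by ring)
    fun huv hpq => ?_
  rw [Sym2.eq_iff] at huv hpq
  rcases hpq with ⟨h₃, -⟩ | ⟨h₃, -⟩
  · refine Or.inr ⟨?_, ?_, ?_⟩ <;> rcases huv with ⟨h₁, h₂⟩ | ⟨h₁, -⟩ <;> linarith
  · refine Or.inl ⟨?_, ?_, ?_⟩ <;> rcases huv with ⟨h₁, -⟩ | ⟨h₁, -⟩ <;> linarith

theorem twoFThreePositive_of_positivityRegion (ha : 0 < a) (h : PositivityRegion a b c) :
    TwoFThreePositive a b c := by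
  have of_quarter_le (hb : 1 / 4 ≤ b) (hac : a ≤ 1 + c) (hac' : a ≤ 1 + c / 2 - 1 / 4)
      (habc : a ≤ b + c) (habc' : a ≤ b + c / 2 - 1 / 4) : TwoFThreePositive a b c := by
    rcases le_or_gt b 1 with hb₁ | hb₁
    · exact .of_le_one ha hb hb₁ habc habc'
    · exact .of_lt (by linarith) hb₁ (.of_le_one ha (by norm_num) le_rfl hac hac')
  simp only [PositivityRegion, le_min_iff] at h
  rcases h with ⟨hc, ⟨hac, habc⟩, hb⟩ | ⟨hc, hb, ⟨ha₁, habc⟩ | ⟨ha₁, hac, habc, h₁, h₂, h₃⟩⟩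
  · exact of_quarter_le hb (by linarith) (by linarith) habc (by linarith)
  · exact of_quarter_le hb (by linarith) (by linarith) (by linarith) habc
  · rcases le_total b (1 / 2) with hb₁ | hb₁
    · exact .of_le_half ha₁ hb hb₁ habc h₃
    · rcases le_total c (a - 1 / 2) with hca | hca
      · exact .of_le_sub_half ha₁ hca hac habc h₂
      · exact .of_half_le ha₁ hb₁ hca h₁

theorem twoFThreeCoeff_of_isExceptional (h : IsExceptional a b c) :
    twoFThreeCoeff a b c = besselSqCoeff 1 := by
  ext k
  have := poch_pos (by norm_num : (0 : ℝ) < 1 / 2) k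
  have := poch_pos (by norm_num : (0 : ℝ) < 3 / 2) k
  have := poch_pos (by norm_num : (0 : ℝ) < 2) k
  rcases h with ⟨rfl, rfl, rfl⟩ | ⟨rfl, rfl, rfl⟩ <;>
  · simp only [twoFThreeCoeff, besselSqCoeff, zeroFOneCoeff, pochRatio, Pi.mul_apply,
      div_mul_div_comm]
    norm_num only
    rw [div_eq_div_iff (by positivity) (by positivity)]
    ring

theorem factorial_two_mul_add_one (k : ℕ) :
    ((2 * k + 1).factorial : ℝ) = 4 ^ k * (k.factorial * poch (3 / 2) k) := by
  have hone : ((2 * k + 1).factorial : ℝ) = poch 2 (2 * k) := by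
    have h := poch_add 1 1 (2 * k)
    norm_num [ascPochhammer_eval_one, add_comm 1 (2 * k)] at h
    exact h
  have htwo := poch_two_mul 1 k
  norm_num [ascPochhammer_eval_one] at htwo
  rw [hone, htwo]

theorem altSeries_zeroFOneCoeff_three_halves (hx : x ≠ 0) :
    altSeries (zeroFOneCoeff (3 / 2)) ((x / 2) ^ 2) = Real.sin x / x := by
  refine Eq.trans (tsum_congr fun k => ?_) ((Real.hasSum_sin x).div_const x).tsum_eq
  rw [zeroFOneCoeff, factorial_two_mul_add_one, neg_pow, div_pow, div_pow, ← pow_mul x,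
    pow_succ x (2 * k)]
  norm_num
  field_simp

theorem altSeries_twoFThreeCoeff_of_isExceptional (h : IsExceptional a b c) (hx : x ≠ 0) :
    altSeries (twoFThreeCoeff a b c) (x ^ 2) = (Real.sin x / x) ^ 2 := by
  rw [twoFThreeCoeff_of_isExceptional h, ← altSeries_zeroFOneCoeff_three_halves hx]
  convert! altSeries_besselSqCoeff one_pos ((x / 2) ^ 2) using 2
  · ring
  · norm_num

end TwoFThree

section BetaIntegral

variable {p q a b x : ℝ}

theorem integral_sub_rpow_mul_rpow (hp : 0 < p) (hq : 0 < q) (hx : 0 < x) :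
    ∫ s in (0 : ℝ)..x, (x - s) ^ (q - 1) * s ^ (p - 1) = x ^ (p + q - 1) * beta p q := by
  have hbeta : (beta p q : ℂ) = Complex.betaIntegral p q := by
    rw [Complex.betaIntegral_eq_Gamma_mul_div _ _ (by simpa) (by simpa), beta]
    push_cast [← Complex.Gamma_ofReal]
    rfl
  rw [← Complex.ofReal_inj, ← intervalIntegral.integral_ofReal, Complex.ofReal_mul, hbeta,
    Complex.ofReal_cpow hx.le]
  push_cast
  rw [← Complex.betaIntegral_scaled p q hx]
  refine intervalIntegral.integral_congr fun s hs => ?_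
  rw [uIcc_of_le hx.le] at hs
  rw [Complex.ofReal_cpow (sub_nonneg.2 hs.2), Complex.ofReal_cpow hs.1, mul_comm]
  push_cast
  rfl

theorem intervalIntegrable_sub_rpow_mul_rpow (hp : 0 < p) (hq : 0 < q) (hx : 0 < x) :
    IntervalIntegrable (fun s => (x - s) ^ (q - 1) * s ^ (p - 1)) volume 0 x := by
  refine intervalIntegral.intervalIntegrable_of_integral_ne_zero ?_
  rw [integral_sub_rpow_mul_rpow hp hq hx]
  exact (mul_pos (Real.rpow_pos_of_pos hx _) (beta_pos hp hq)).ne'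

theorem beta_natCast_add (hp : 0 < p) (hq : 0 < q) (n : ℕ) :
    beta (n + p) q = pochRatio p (p + q) n * beta p q := by
  rw [beta, beta, pochRatio, add_assoc, Gamma_natCast_add hp, Gamma_natCast_add (by positivity),
    div_mul_div_comm, mul_assoc]

theorem pochRatio_two_mul (u v : ℝ) (k : ℕ) :
    pochRatio (2 * u) (2 * v) (2 * k) = pochRatio u v k * pochRatio (u + 1 / 2) (v + 1 / 2) k := by
  simp only [pochRatio, poch_two_mul]
  rw [mul_div_mul_left _ _ (by positivity), mul_div_mul_comm]

theorem EntireCoeff.integral_sub_rpow_mul_rpow_mul_altSeries {t : ℕ → ℝ} (ht : EntireCoeff t)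
    (ha : 0 < a) (hb : 0 < b) (hx : 0 < x) (r : ℝ) :
    ∫ s in (0 : ℝ)..x, (x - s) ^ (2 * b - 1) * s ^ (2 * a - 1) * altSeries t ((s / r) ^ 2) =
      x ^ (2 * a + 2 * b - 1) * beta (2 * a) (2 * b) *
        altSeries (t * (pochRatio a (a + b) * pochRatio (a + 1 / 2) (a + b + 1 / 2)))
          ((x / r) ^ 2) := by
  have ha₂ : 0 < 2 * a := by positivity
  have hb₂ : 0 < 2 * b := by positivity
  have hmoment (k : ℕ) :
      ∫ s in (0 : ℝ)..x, (x - s) ^ (2 * b - 1) * s ^ (2 * a - 1) * ((s / r) ^ 2) ^ k =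
        x ^ (2 * a + 2 * b - 1) * beta (2 * a) (2 * b) *
          ((pochRatio a (a + b) k * pochRatio (a + 1 / 2) (a + b + 1 / 2) k) *
            ((x / r) ^ 2) ^ k) := by
    calc ∫ s in (0 : ℝ)..x, (x - s) ^ (2 * b - 1) * s ^ (2 * a - 1) * ((s / r) ^ 2) ^ k
        = ∫ s in (0 : ℝ)..x,
            r⁻¹ ^ (2 * k) * ((x - s) ^ (2 * b - 1) * s ^ (((2 * k : ℕ) : ℝ) + 2 * a - 1)) := by
          refine intervalIntegral.integral_congr_ae (.of_forall fun s hs => ?_)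
          rw [uIoc_of_le hx.le] at hs
          rw [add_sub_assoc, Real.rpow_add hs.1, Real.rpow_natCast, div_eq_mul_inv, ← pow_mul,
            mul_pow]
          ring
      _ = r⁻¹ ^ (2 * k) * (x ^ (2 * k) * x ^ (2 * a + 2 * b - 1) *
            (pochRatio (2 * a) (2 * (a + b)) (2 * k) * beta (2 * a) (2 * b))) := by
          rw [intervalIntegral.integral_const_mul,
            integral_sub_rpow_mul_rpow (by positivity) hb₂ hx, beta_natCast_add ha₂ hb₂, mul_add 2,
            add_assoc, add_sub_assoc, Real.rpow_add hx, Real.rpow_natCast]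
      _ = _ := by
          rw [pochRatio_two_mul, ← pow_mul, div_eq_mul_inv x, mul_pow]
          ring
  rw [← (ht.hasSum_integral_mul_altSeries (g := fun s => (s / r) ^ 2)
    (intervalIntegrable_sub_rpow_mul_rpow ha₂ hb₂ hx) (by fun_prop)).tsum_eq, altSeries,
    ← tsum_mul_left]
  refine tsum_congr fun k => ?_
  rw [hmoment, neg_pow ((x / r) ^ 2), Pi.mul_apply, Pi.mul_apply]
  ring

end BetaIntegral

/-- Condition (i) or (ii) of part (B). -/
def BesselRegion (α lam μ : ℝ) : Prop :=
  (α ≤ -1 / 2 ∧ -1 / 2 ≤ lam ∧ -α - 1 < μ ∧ μ ≤ min (α + 1) (lam + α)) ∨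
    (-1 / 2 ≤ α ∧ -1 / 2 ≤ lam ∧
      ((-α - 1 < μ ∧ μ ≤ min (-α) (lam - 1 / 2)) ∨
        (-α ≤ μ ∧
          μ ≤ min (α + 1) (min (lam + α) (min (lam + 1 / 2)
            (min (2 * lam + 1 / 2) (1 / 2 * (lam + α + 1 / 2))))))))

/-- The two parameter triples for which the integral of part (B) has zeros. -/
def IsBesselExceptional (α lam μ : ℝ) : Prop :=
  (α = -1 / 2 ∧ lam = 1 ∧ μ = 1 / 2) ∨ (α = 1 / 2 ∧ lam = 0 ∧ μ = 1 / 2)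

section Bessel

variable {α lam μ a b c x t : ℝ}

theorem besselJ_eq_altSeries (hα : -1 < α) (ht : 0 < t) :
    besselJ α t =
      (t / 2) ^ α / Real.Gamma (α + 1) * altSeries (zeroFOneCoeff (α + 1)) ((t / 2) ^ 2) := by
  have hα₁ : 0 < α + 1 := by linarith
  rw [besselJ, altSeries, ← tsum_mul_left]
  refine tsum_congr fun n => ?_
  rw [add_assoc, Gamma_natCast_add hα₁, add_comm _ α, Real.rpow_add (by positivity), zeroFOneCoeff,
    ← Nat.cast_ofNat, ← Nat.cast_mul, Real.rpow_natCast, neg_pow ((t / _) ^ 2), ← pow_mul]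
  have := (poch_pos hα₁ n).ne'
  have := (Real.Gamma_pos_of_pos hα₁).ne'
  field_simp

theorem besselIntegrand_eq (hc : -1 < c) (ht : 0 < t) (a b x : ℝ) :
    besselIntegrand c (2 * b - 1) (2 * a - c - 1) x t = (2 ^ c * Real.Gamma (c + 1))⁻¹ *
      ((x - t) ^ (2 * b - 1) * t ^ (2 * a - 1) *
        altSeries (zeroFOneCoeff (c + 1)) ((t / 2) ^ 2)) := by
  have hsub : 2 * a - c - 1 = 2 * a - 1 - c := by ring
  rw [besselIntegrand, besselJ_eq_altSeries hc ht, Real.div_rpow ht.le zero_le_two, hsub,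
    Real.rpow_sub ht (2 * a - 1)]
  have := (Real.rpow_pos_of_pos ht c).ne'
  field_simp

theorem intervalIntegrable_besselIntegrand (hc : -1 < c) (ha : 0 < a) (hb : 0 < b) (hx : 0 < x) :
    IntervalIntegrable (besselIntegrand c (2 * b - 1) (2 * a - c - 1) x) volume 0 x := by
  have hcont : Continuous fun s : ℝ => altSeries (zeroFOneCoeff (c + 1)) ((s / 2) ^ 2) :=
    (entireCoeff_zeroFOneCoeff (by linarith)).continuous_altSeries.comp (by fun_prop)
  refine (((intervalIntegrable_sub_rpow_mul_rpow (p := 2 * a) (q := 2 * b) (by positivity)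
    (by positivity) hx).mul_continuousOn hcont.continuousOn).const_mul
      (2 ^ c * Real.Gamma (c + 1))⁻¹).congr fun s hs => ?_
  rw [uIoc_of_le hx.le] at hs
  exact (besselIntegrand_eq hc hs.1 a b x).symm

theorem besselIntegral_eq (hc : -1 < c) (ha : 0 < a) (hb : 0 < b) (hx : 0 < x) :
    besselIntegral c (2 * b - 1) (2 * a - c - 1) x =
      (2 ^ c * Real.Gamma (c + 1))⁻¹ * (x ^ (2 * a + 2 * b - 1) * beta (2 * a) (2 * b)) *
        altSeries (twoFThreeCoeff a b c) ((x / 2) ^ 2) := by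
  have hentire : EntireCoeff (zeroFOneCoeff (c + 1)) := entireCoeff_zeroFOneCoeff (by linarith)
  rw [mul_assoc, twoFThreeCoeff, ← hentire.integral_sub_rpow_mul_rpow_mul_altSeries ha hb hx,
    ← intervalIntegral.integral_const_mul]
  refine intervalIntegral.integral_congr_ae (.of_forall fun s hs => ?_)
  rw [uIoc_of_le hx.le] at hs
  exact besselIntegrand_eq hc hs.1 a b x

theorem besselIntegral_factor_pos (hc : -1 < c) (ha : 0 < a) (hb : 0 < b) (hx : 0 < x) :
    0 < (2 ^ c * Real.Gamma (c + 1))⁻¹ * (x ^ (2 * a + 2 * b - 1) * beta (2 * a) (2 * b)) := by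
  have := Real.Gamma_pos_of_pos (by linarith : 0 < c + 1)
  have := beta_pos (by positivity : 0 < 2 * a) (by positivity : 0 < 2 * b)
  positivity

theorem besselIntegral_nonneg_iff (hc : -1 < c) (ha : 0 < a) (hb : 0 < b) (hx : 0 < x) :
    0 ≤ besselIntegral c (2 * b - 1) (2 * a - c - 1) x ↔
      0 ≤ altSeries (twoFThreeCoeff a b c) ((x / 2) ^ 2) := by
  rw [besselIntegral_eq hc ha hb hx,
    mul_nonneg_iff_of_pos_left (besselIntegral_factor_pos hc ha hb hx)]

theorem besselIntegral_pos_iff (hc : -1 < c) (ha : 0 < a) (hb : 0 < b) (hx : 0 < x) :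
    0 < besselIntegral c (2 * b - 1) (2 * a - c - 1) x ↔
      0 < altSeries (twoFThreeCoeff a b c) ((x / 2) ^ 2) := by
  rw [besselIntegral_eq hc ha hb hx,
    mul_pos_iff_of_pos_left (besselIntegral_factor_pos hc ha hb hx)]

theorem BesselRegion.exists_positivityRegion (h : BesselRegion α lam μ) :
    ∃ a b, 0 < a ∧ 0 < b ∧ PositivityRegion a b α ∧ lam = 2 * b - 1 ∧ μ = 2 * a - α - 1 := by
  refine ⟨(α + μ + 1) / 2, (lam + 1) / 2, ?_, ?_, ?_, by ring, by ring⟩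
  · rcases h with ⟨-, -, h, -⟩ | ⟨_, -, ⟨h, -⟩ | ⟨h, -⟩⟩ <;> linarith
  · rcases h with ⟨-, h, -⟩ | ⟨-, h, -⟩ <;> linarith
  · simp only [BesselRegion, PositivityRegion, le_min_iff] at h ⊢
    rcases h with ⟨h₁, h₂, -, h₃, h₄⟩ | ⟨h₁, h₂, ⟨-, h₃, h₄⟩ | ⟨h₃, h₄, h₅, h₆, h₇, h₈⟩⟩
    · exact Or.inl ⟨h₁, ⟨by linarith, by linarith⟩, by linarith⟩
    · exact Or.inr ⟨h₁, by linarith, Or.inl ⟨by linarith, by linarith⟩⟩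
    · exact Or.inr ⟨h₁, by linarith, Or.inr ⟨by linarith, by linarith, by linarith,
        by linarith, by linarith, by linarith⟩⟩

theorem IsExceptional.isBesselExceptional (h : IsExceptional a b c) :
    IsBesselExceptional c (2 * b - 1) (2 * a - c - 1) := by
  rcases h with ⟨rfl, rfl, rfl⟩ | ⟨rfl, rfl, rfl⟩ <;> norm_num [IsBesselExceptional]

theorem IsBesselExceptional.besselIntegral_eq (h : IsBesselExceptional α lam μ) (hx : 0 < x) :
    besselIntegral α lam μ x = 2 * Real.sqrt (2 / Real.pi) * Real.sin (x / 2) ^ 2 := by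
  have hsqrt : Real.sqrt 2 ^ 2 = 2 := Real.sq_sqrt zero_le_two
  have : 0 < Real.sqrt 2 := by positivity
  have : 0 < Real.sqrt Real.pi := Real.sqrt_pos.2 Real.pi_pos
  rw [Real.sqrt_div zero_le_two]
  rcases h with ⟨rfl, rfl, rfl⟩ | ⟨rfl, rfl, rfl⟩
  · have h := _root_.besselIntegral_eq (a := 1 / 2) (b := 1) (c := -1 / 2) (by norm_num)
      (by norm_num) (by norm_num) hx
    rw [altSeries_twoFThreeCoeff_of_isExceptional (.inl ⟨rfl, rfl, rfl⟩) (by positivity)] at h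
    norm_num [beta, Real.Gamma_one_half_eq, Real.rpow_neg, ← Real.sqrt_eq_rpow] at h ⊢
    rw [h]
    field_simp
  · have h := _root_.besselIntegral_eq (a := 1) (b := 1 / 2) (c := 1 / 2) (by norm_num)
      (by norm_num) (by norm_num) hx
    rw [altSeries_twoFThreeCoeff_of_isExceptional (.inr ⟨rfl, rfl, rfl⟩) (by positivity),
      Real.Gamma_add_one (by norm_num)] at h
    norm_num [beta, Real.Gamma_one_half_eq, ← Real.sqrt_eq_rpow] at h ⊢
    rw [h]
    field_simp
    linear_combination -Real.sin (x / 2) ^ 2 * hsqrt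

theorem integral_sin_eq_two_mul_sin_sq (x : ℝ) :
    ∫ t in (0 : ℝ)..x, Real.sin t = 2 * Real.sin (x / 2) ^ 2 := by
  rw [integral_sin, Real.cos_zero, Real.sin_sq_eq_half_sub, mul_div_cancel₀ x two_ne_zero]
  ring

theorem integral_sub_mul_cos (x : ℝ) :
    ∫ t in (0 : ℝ)..x, (x - t) * Real.cos t = ∫ t in (0 : ℝ)..x, Real.sin t := by
  rw [intervalIntegral.integral_mul_deriv_eq_deriv_mul (u' := fun _ => -1) (v := Real.sin)
    (fun t _ => by simpa using (hasDerivAt_id t).const_sub x) (fun t _ => Real.hasDerivAt_sin t)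
    (by simp) (by apply Continuous.intervalIntegrable; fun_prop)]
  simp

end Bessel

theorem theorem5 :
    -- positivity of the hypergeometric function
    (∀ a b c : ℝ, 0 < a → 0 < b → -1 < c →
      ((c ≤ -1 / 2 ∧ a ≤ min (c + 1) (b + c) ∧ 1 / 4 ≤ b) ∨
        (-1 / 2 ≤ c ∧ 1 / 4 ≤ b ∧
          (a ≤ min (1 / 2) (b + c / 2 - 1 / 4) ∨
            (1 / 2 ≤ a ∧
              a ≤ min (c + 1) (min (b + c) (min (b + c / 2 + 1 / 4)
                (min (b / 2 + 3 * c / 4 + 3 / 8) (2 * b + c / 2 - 1 / 4)))))))) →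
      (∀ x : ℝ, 0 < x →
        0 ≤ hypergeometric23 a (a + 1 / 2) (c + 1) (a + b) (a + b + 1 / 2) (-x ^ 2)) ∧
      (¬ ((a = 1 / 2 ∧ b = 1 ∧ c = -1 / 2) ∨ (a = 1 ∧ b = 1 / 2 ∧ c = 1 / 2)) →
        ∀ x : ℝ, 0 < x →
          0 < hypergeometric23 a (a + 1 / 2) (c + 1) (a + b) (a + b + 1 / 2) (-x ^ 2)) ∧
      (((a = 1 / 2 ∧ b = 1 ∧ c = -1 / 2) ∨ (a = 1 ∧ b = 1 / 2 ∧ c = 1 / 2)) →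
        ∃ x : ℝ, 0 < x ∧
          hypergeometric23 a (a + 1 / 2) (c + 1) (a + b) (a + b + 1 / 2) (-x ^ 2) = 0)) ∧
    -- positivity of the fractional integrals of Bessel functions
    (∀ α lam μ : ℝ, -1 < α →
      ((α ≤ -1 / 2 ∧ -1 / 2 ≤ lam ∧ -α - 1 < μ ∧ μ ≤ min (α + 1) (lam + α)) ∨
        (-1 / 2 ≤ α ∧ -1 / 2 ≤ lam ∧
          ((-α - 1 < μ ∧ μ ≤ min (-α) (lam - 1 / 2)) ∨
            (-α ≤ μ ∧
              μ ≤ min (α + 1) (min (lam + α) (min (lam + 1 / 2)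
                (min (2 * lam + 1 / 2) (1 / 2 * (lam + α + 1 / 2))))))))) →
      (∀ x : ℝ, 0 < x →
        IntervalIntegrable (besselIntegrand α lam μ x) MeasureTheory.volume 0 x ∧
          0 ≤ besselIntegral α lam μ x) ∧
      (¬ ((α = -1 / 2 ∧ lam = 1 ∧ μ = 1 / 2) ∨ (α = 1 / 2 ∧ lam = 0 ∧ μ = 1 / 2)) →
        ∀ x : ℝ, 0 < x → 0 < besselIntegral α lam μ x)) ∧
    -- the two exceptional cases
    (∀ α lam μ : ℝ,
      ((α = -1 / 2 ∧ lam = 1 ∧ μ = 1 / 2) ∨ (α = 1 / 2 ∧ lam = 0 ∧ μ = 1 / 2)) →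
      ∀ x : ℝ, 0 < x →
        besselIntegral α lam μ x
            = Real.sqrt (2 / Real.pi) * ∫ t in (0 : ℝ)..x, (x - t) * Real.cos t ∧
        besselIntegral α lam μ x = Real.sqrt (2 / Real.pi) * ∫ t in (0 : ℝ)..x, Real.sin t ∧
        besselIntegral α lam μ x = 2 * Real.sqrt (2 / Real.pi) * Real.sin (x / 2) ^ 2) := by
  refine ⟨fun a b c ha _ _ h => ?_, fun α lam μ hα h => ?_, fun α lam μ h x hx => ?_⟩
  · have hpos := twoFThreePositive_of_positivityRegion ha h
    simp only [hypergeometric23_eq_altSeries]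
    refine ⟨fun x hx => hpos.altNonneg.nonneg _ (by positivity),
      fun hne x hx => hpos.pos hne _ (by positivity), fun he => ⟨Real.pi, Real.pi_pos, ?_⟩⟩
    rw [altSeries_twoFThreeCoeff_of_isExceptional he Real.pi_ne_zero]
    simp
  · obtain ⟨a, b, ha, hb, hab, rfl, rfl⟩ := BesselRegion.exists_positivityRegion h
    have hpos := twoFThreePositive_of_positivityRegion ha hab
    refine ⟨fun x hx => ⟨intervalIntegrable_besselIntegrand hα ha hb hx, ?_⟩, fun hne x hx => ?_⟩
    · exact (besselIntegral_nonneg_iff hα ha hb hx).2 (hpos.altNonneg.nonneg _ (by positivity))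
    · exact (besselIntegral_pos_iff hα ha hb hx).2
        (hpos.pos (fun he => hne he.isBesselExceptional) _ (by positivity))
  · have heq := IsBesselExceptional.besselIntegral_eq h hx
    rw [integral_sub_mul_cos, integral_sin_eq_two_mul_sin_sq]
    exact ⟨by linarith, by linarith, heq⟩
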